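/- All graphs are finite, simple and undirected. For a graph $G$ and a set $S\subseteq V(G)$ of vertices, colour the vertices of $S$ blue and all others white, and repeatedly apply the rule: if a blue vertex has exactly one white neighbour, then that neighbour becomes blue. The set $S$ is a zero forcing set if all vertices are blue once no further colour change is possible; otherwise it is a failed set. A minimal zero forcing set is a zero forcing set no proper subset of which is a zero forcing set, and a minimum zero forcing set is one of smallest cardinality among all zero forcing sets of $G$; $G$ is well-forced if every minimal zero forcing set of $G$ is a minimum zero forcing set. A maximal failed set is a failed set $S$ such that for every $v\in V(G)\setminus S$ the set $S\cup\{v\}$ is not failed, and a maximum failed set is one of largest cardinality among all failed sets of $G$; $G$ is well-failed if every maximal failed set of $G$ is a maximum failed set. Let $\operatorname{star}_{2,2,2}$ be the tree on seven vertices obtained from the star $K_{1,3}$ by subdividing every edge once. **Corollary 3.13.** Let $T$ be a tree that is well-failed, is not a path, and is not (isomorphic to) $\operatorname{star}_{2,2,2}$. Then $T$ is well-forced; that is, all minimal zero forcing sets of $T$ have the same cardinality. -/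

import Mathlib

/-- `Blue G S v`: starting from the set `S` of blue vertices of `G`, the vertex `v` is eventually
coloured blue when the colour change rule is applied as long as possible: a blue vertex `u` all of
whose neighbours other than `v` are blue turns its neighbour `v` blue. -/
inductive Blue {V : Type*} (G : SimpleGraph V) (S : Set V) : V → Prop
  | start (v : V) (hv : v ∈ S) : Blue G S v
  | force (u v : V) (hu : Blue G S u) (huv : G.Adj u v)
      (hw : ∀ w, G.Adj u w → w ≠ v → Blue G S w) : Blue G S v

/-- The closure of `S`: the set of all vertices that are finally blue. -/
def zfClosure {V : Type*} (G : SimpleGraph V) (S : Set V) : Set V :=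
  {v | Blue G S v}

/-- Zero forcing sets: the closure is the whole vertex set. -/
def IsZeroForcing {V : Type*} (G : SimpleGraph V) (S : Set V) : Prop :=
  zfClosure G S = Set.univ

/-- Failed zero forcing sets. -/
def IsFailed {V : Type*} (G : SimpleGraph V) (S : Set V) : Prop :=
  ¬ IsZeroForcing G S

/-- A maximal failed set: a failed set such that adding any further vertex gives a set that is
not failed. -/
def IsMaximalFailed {V : Type*} (G : SimpleGraph V) (S : Set V) : Prop :=
  IsFailed G S ∧ ∀ v, v ∉ S → ¬ IsFailed G (insert v S)

/-- A maximum failed set: a failed set of largest cardinality. -/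
def IsMaximumFailed {V : Type*} (G : SimpleGraph V) (S : Set V) : Prop :=
  IsFailed G S ∧ ∀ T, IsFailed G T → T.ncard ≤ S.ncard

/-- A graph is well-failed if every maximal failed set is a maximum failed set. -/
def WellFailed {V : Type*} (G : SimpleGraph V) : Prop :=
  ∀ S, IsMaximalFailed G S → IsMaximumFailed G S

/-- A minimal zero forcing set: no proper subset is a zero forcing set. -/
def IsMinimalZeroForcing {V : Type*} (G : SimpleGraph V) (S : Set V) : Prop :=
  IsZeroForcing G S ∧ ∀ T, T ⊂ S → ¬ IsZeroForcing G T

/-- A minimum zero forcing set: a zero forcing set of smallest cardinality. -/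
def IsMinimumZeroForcing {V : Type*} (G : SimpleGraph V) (S : Set V) : Prop :=
  IsZeroForcing G S ∧ ∀ T, IsZeroForcing G T → S.ncard ≤ T.ncard

/-- A graph is well-forced if every minimal zero forcing set is a minimum zero forcing set. -/
def WellForced {V : Type*} (G : SimpleGraph V) : Prop :=
  ∀ S, IsMinimalZeroForcing G S → IsMinimumZeroForcing G S

/-- A path: a graph isomorphic to the path `P_n` for some `n`. -/
def IsPathOnSomeVertices {V : Type*} (G : SimpleGraph V) : Prop :=
  ∃ n : ℕ, Nonempty (G ≃g SimpleGraph.pathGraph n)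

/-- The tree obtained from the star `K_{1,3}` by subdividing every edge once: the centre is `0`,
its neighbours are `1, 2, 3`, and the leaves are `4, 5, 6`. -/
def star222 : SimpleGraph (Fin 7) :=
  SimpleGraph.fromEdgeSet {s(0, 1), s(0, 2), s(0, 3), s(1, 4), s(2, 5), s(3, 6)}

/-!
A set is zero forcing exactly when it meets every fort, that is, every nonempty vertex set `F` such
that no vertex outside `F` has exactly one neighbour in `F`. The maximal failed sets are therefore
the complements of the minimal forts, and in a well-failed graph all minimal forts have the same
number `k` of elements (`WellFailed.ncard_eq`).

If the tree has two leaves with a common neighbour, they form a minimal fort, so `k = 2`. The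
minimal forts are then the pairs of distinct equivalent elements of an equivalence relation, the
minimal zero forcing sets omit exactly one element of each nontrivial class, and the graph is
well-forced (`wellForced_of_forall_ncard_eq_two`).

It remains to see that a well-failed tree without such twin leaves is a path or `star222`. Many
minimal forts can be written down: starting with a vertex `a`, put every leaf adjacent to a vertex
of the fort into the fort, and for every other neighbour `h` choose one further neighbour of `h`
(`IsBranchFort.of_isContinuation`, `IsBranchFort.minimal_isFort_union`). Let `s a h` be the size of
the part of such a fort that lies beyond the neighbour `h` of `a`. As all these forts have `k`
elements, `s a p + s b p = k` for any two neighbours `a`, `b` of `p`, and the values `s v h` over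
the neighbours `h` of `v` have sum `k - 1` (`exists_isContinuationSize`). At a vertex `v` of degree
at least three the first relation gives `s f v = k / 2` for every neighbour `f`. Following the paths
that leave `v`, one finds `s v f ≥ k / 2 - 1` (`IsContinuationSize.not_lt_and_lt`), and the second
relation then forces `k = 4` and three legs of length two at `v`
(`IsContinuationSize.nonempty_iso_star222`). A tree in which no vertex has degree at least three is
a path.
-/

/-! ### Forts and zero forcing -/

/-- `IsFortOn G B F`: no vertex of `B` outside `F` has exactly one neighbour in `F`. -/
def IsFortOn {V : Type*} (G : SimpleGraph V) (B F : Set V) : Prop :=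
  ∀ u ∈ B, u ∉ F → ∀ x ∈ F, G.Adj u x → ∃ y ∈ F, y ≠ x ∧ G.Adj u y

/-- A fort: a nonempty vertex set `F` such that no vertex outside `F` has exactly one neighbour
in `F`. -/
def IsFort {V : Type*} (G : SimpleGraph V) (F : Set V) : Prop :=
  F.Nonempty ∧ IsFortOn G Set.univ F

theorem isZeroForcing_iff_forall_isFort {V : Type*} {G : SimpleGraph V} {S : Set V} :
    IsZeroForcing G S ↔ ∀ F, IsFort G F → (S ∩ F).Nonempty := by
  constructor
  · intro hS F ⟨⟨v, hv⟩, hF⟩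
    by_contra hne
    have key : ∀ v, Blue G S v → v ∉ F := by
      intro v hv
      induction hv with
      | start v hv => exact fun hvF => hne ⟨v, hv, hvF⟩
      | force u v _ huv _ hu hw =>
        intro hvF
        obtain ⟨y, hy, hyv, huy⟩ := hF u trivial hu v hvF huv
        exact hw y huy hyv hy
    exact key v (hS.symm ▸ Set.mem_univ v : v ∈ zfClosure G S) hv
  · intro h
    by_contra hS
    obtain ⟨x, hxS, hx⟩ := h (zfClosure G S)ᶜ
      ⟨Set.nonempty_compl.2 hS, fun u _ hu x hx hux => by
        by_contra hy
        push Not at hy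
        refine hx (Blue.force u x (not_not.1 hu) hux fun w huw hwx => ?_)
        by_contra hw
        exact hy w hw hwx huw⟩
    exact hx (Blue.start x hxS)

theorem isMaximalFailed_compl {V : Type*} {G : SimpleGraph V} {F : Set V}
    (hF : Minimal (IsFort G) F) : IsMaximalFailed G Fᶜ := by
  constructor
  · intro h
    obtain ⟨x, hx, hx'⟩ := isZeroForcing_iff_forall_isFort.1 h F hF.prop
    exact hx hx'
  · intro v hv
    rw [IsFailed, not_not, isZeroForcing_iff_forall_isFort]
    intro F' hF'
    by_contra hne
    have hsub : F' ⊆ F := fun x hx => by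
      by_contra hxF
      exact hne ⟨x, Or.inr hxF, hx⟩
    exact hne ⟨v, Or.inl rfl, hF.le_of_le hF' hsub (not_not.1 hv)⟩

theorem WellFailed.ncard_eq {V : Type*} [Finite V] {G : SimpleGraph V} (hG : WellFailed G)
    {F F' : Set V} (hF : Minimal (IsFort G) F) (hF' : Minimal (IsFort G) F') :
    F.ncard = F'.ncard := by
  have h1 := (hG _ (isMaximalFailed_compl hF)).2 _ (isMaximalFailed_compl hF').1
  have h2 := (hG _ (isMaximalFailed_compl hF')).2 _ (isMaximalFailed_compl hF).1
  have h3 := Set.ncard_add_ncard_compl F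
  have h4 := Set.ncard_add_ncard_compl F'
  omega

theorem IsFort.exists_minimal_subset {V : Type*} [Finite V] {G : SimpleGraph V} {F : Set V}
    (hF : IsFort G F) : ∃ F' ⊆ F, Minimal (IsFort G) F' :=
  exists_minimal_le_of_wellFoundedLT _ F hF

/-! ### Forts with two vertices -/

theorem isFort_pair_iff {V : Type*} {G : SimpleGraph V} {x y : V} (hxy : x ≠ y) :
    IsFort G {x, y} ↔ ∀ u, u ≠ x → u ≠ y → (G.Adj u x ↔ G.Adj u y) := by
  constructor
  · intro h u hx hy
    have hu : u ∉ ({x, y} : Set V) := by simp [hx, hy]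
    constructor
    · intro hux
      obtain ⟨z, hz, hzx, huz⟩ := h.2 u trivial hu x (by simp) hux
      obtain rfl | rfl := hz
      · exact absurd rfl hzx
      · exact huz
    · intro huy
      obtain ⟨z, hz, hzy, huz⟩ := h.2 u trivial hu y (by simp) huy
      obtain rfl | rfl := hz
      · exact huz
      · exact absurd rfl hzy
  · intro h
    refine ⟨⟨x, by simp⟩, fun u _ hu z hz huz => ?_⟩
    have hux : u ≠ x := fun e => hu (by simp [e])
    have huy : u ≠ y := fun e => hu (by simp [e])
    obtain rfl | rfl := hz
    · exact ⟨y, by simp, hxy.symm, (h u hux huy).1 huz⟩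
    · exact ⟨x, by simp, hxy, (h u hux huy).2 huz⟩

/-- Being equal or forming a two-element fort is a transitive relation. -/
theorem IsFort.pair_trans {V : Type*} {G : SimpleGraph V} {x y z : V} (hxy : x ≠ y) (hyz : y ≠ z)
    (hxz : x ≠ z) (h1 : IsFort G {x, y}) (h2 : IsFort G {y, z}) : IsFort G {x, z} := by
  rw [isFort_pair_iff hxy] at h1
  rw [isFort_pair_iff hyz] at h2
  rw [isFort_pair_iff hxz]
  intro u hux huz
  obtain rfl | huy := eq_or_ne u y
  · rw [G.adj_comm u x, h2 x hxy hxz, G.adj_comm x z, h1 z hxz.symm hyz.symm, G.adj_comm]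
  · rw [h1 u hux huy, h2 u huy huz]

/-- If all minimal forts are pairs, they are the pairs of distinct elements in the classes of an
equivalence relation. A minimal zero forcing set omits exactly one element of each class with at
least two elements, and every zero forcing set omits at most one, which gives an injection between
complements. -/
theorem wellForced_of_forall_ncard_eq_two {V : Type*} [Finite V] {G : SimpleGraph V}
    (h : ∀ F, Minimal (IsFort G) F → F.ncard = 2) : WellForced G := by
  intro S hS
  refine ⟨hS.1, fun T hT => ?_⟩
  have hpartner : ∀ x ∈ S, ∃ y, y ∉ S ∧ x ≠ y ∧ IsFort G {x, y} := by
    intro x hx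
    have hnot := hS.2 (S \ {x}) ⟨Set.sdiff_subset, fun hsub => (hsub hx).2 rfl⟩
    rw [isZeroForcing_iff_forall_isFort] at hnot
    push Not at hnot
    obtain ⟨F, hF, hSF⟩ := hnot
    obtain ⟨F', hF'F, hF'⟩ := hF.exists_minimal_subset
    have honly : ∀ w ∈ S, w ∈ F' → w = x := by
      intro w hwS hwF
      by_contra hwx
      exact Set.eq_empty_iff_forall_notMem.1 hSF w ⟨⟨hwS, hwx⟩, hF'F hwF⟩
    obtain ⟨w, hwS, hwF⟩ := isZeroForcing_iff_forall_isFort.1 hS.1 F' hF'.prop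
    obtain rfl := honly w hwS hwF
    obtain ⟨a, b, hab, rfl⟩ := Set.ncard_eq_two.1 (h F' hF')
    obtain rfl | rfl := hwF
    · exact ⟨b, fun hb => hab (honly b hb (by simp)).symm, hab, hF'.prop⟩
    · exact ⟨a, fun ha => hab (honly a ha (by simp)), hab.symm, Set.pair_comm a w ▸ hF'.prop⟩
  have hTpair : ∀ x y, x ∉ T → y ∉ T → ¬ IsFort G {x, y} := by
    intro x y hx hy hF
    obtain ⟨w, hwT, hw⟩ := isZeroForcing_iff_forall_isFort.1 hT _ hF
    obtain rfl | rfl := hw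
    · exact hx hwT
    · exact hy hwT
  choose! f hfS hfne hfF using hpartner
  classical
  have hcard : Tᶜ.ncard ≤ Sᶜ.ncard := by
    refine Set.ncard_le_ncard_of_injOn (fun u => if u ∈ S then f u else u) ?_ ?_
    · intro u _
      by_cases hu : u ∈ S
      · simpa [hu] using hfS u hu
      · simp [hu]
    · intro u hu u' hu' huu'
      by_contra hne
      refine hTpair u u' hu hu' ?_
      by_cases h1 : u ∈ S <;> by_cases h2 : u' ∈ S <;> simp only [h1, h2, if_true, if_false] at huu'
      · have := hfF u' h2
        rw [← huu', Set.pair_comm] at this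
        exact (hfF u h1).pair_trans (hfne u h1) (huu' ▸ (hfne u' h2).symm) hne this
      · exact huu' ▸ hfF u h1
      · have := hfF u' h2
        rwa [← huu', Set.pair_comm] at this
      · exact absurd huu' hne
  have h3 := Set.ncard_add_ncard_compl S
  have h4 := Set.ncard_add_ncard_compl T
  omega

/-! ### Leaves and closed vertex sets -/

/-- A vertex with at most one neighbour. In a connected graph on at least two vertices these are
the vertices of degree one. -/
def IsLeafVertex {V : Type*} (G : SimpleGraph V) (x : V) : Prop :=
  ∀ y z, G.Adj x y → G.Adj x z → y = z

/-- Two distinct leaves with a common neighbour form a minimal fort. -/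
theorem minimal_isFort_pair_of_isLeafVertex {V : Type*} {G : SimpleGraph V} {p x y : V}
    (hpx : G.Adj p x) (hpy : G.Adj p y) (hx : IsLeafVertex G x) (hy : IsLeafVertex G y)
    (hxy : x ≠ y) : Minimal (IsFort G) {x, y} := by
  refine ⟨(isFort_pair_iff hxy).2 fun u _ _ => ?_, fun F hF hsub => ?_⟩
  · constructor
    · intro h
      rw [hx u p h.symm hpx.symm]
      exact hpy
    · intro h
      rw [hy u p h.symm hpy.symm]
      exact hpx
  · have hp : p ∉ F := fun h => by
      obtain rfl | rfl := hsub h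
      · exact hpx.ne rfl
      · exact hpy.ne rfl
    obtain ⟨w, hw⟩ := hF.1
    have hboth : x ∈ F ∧ y ∈ F := by
      obtain rfl | rfl := hsub hw
      · obtain ⟨z, hz, hzw, _⟩ := hF.2 p trivial hp w hw hpx
        obtain rfl | rfl := hsub hz
        · exact absurd rfl hzw
        · exact ⟨hw, hz⟩
      · obtain ⟨z, hz, hzw, _⟩ := hF.2 p trivial hp w hw hpy
        obtain rfl | rfl := hsub hz
        · exact ⟨hz, hw⟩
        · exact absurd rfl hzw
    rintro u (rfl | rfl)
    · exact hboth.1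
    · exact hboth.2

theorem SimpleGraph.Connected.mem_of_forall_adj {V : Type*} {G : SimpleGraph V} (hG : G.Connected)
    {S : Set V} {v : V} (hv : v ∈ S) (hS : ∀ u ∈ S, ∀ w, G.Adj u w → w ∈ S) (u : V) : u ∈ S := by
  obtain ⟨q⟩ := hG.preconnected v u
  induction q with
  | nil => exact hv
  | cons h _ ih => exact ih (hS _ hv _ h)

/-- A finite connected graph with a vertex of degree at most one and no vertex of degree three or
more is a path: the distance from the given vertex is an isomorphism. -/
theorem isPathOnSomeVertices_of_forall_adj {V : Type*} [Finite V] {G : SimpleGraph V}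
    (hG : G.Connected) {r : V} (hr : IsLeafVertex G r)
    (hdeg : ∀ v a b c, G.Adj v a → G.Adj v b → G.Adj v c → a = b ∨ a = c ∨ b = c) :
    IsPathOnSomeVertices G := by
  classical
  have := Fintype.ofFinite V
  have hpred : ∀ d u, G.dist r u = d + 1 → ∃ w, G.Adj w u ∧ G.dist r w = d := by
    intro d u hu
    obtain ⟨q, hq⟩ := hG.exists_walk_length_eq_dist u r
    rw [SimpleGraph.dist_comm, hu] at hq
    cases q with
    | nil => simp at hq
    | @cons _ w _ h q =>
      refine ⟨w, h.symm, ?_⟩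
      have h1 : G.dist r w ≤ d := by
        rw [SimpleGraph.dist_comm]
        exact (SimpleGraph.dist_le q).trans (by simpa using hq.le)
      have h2 := hG.dist_triangle (u := r) (v := w) (w := u)
      rw [SimpleGraph.dist_eq_one_iff_adj.2 h.symm] at h2
      omega
  have hinj : ∀ d u v, G.dist r u = d → G.dist r v = d → u = v := by
    intro d
    induction d with
    | zero =>
      intro u v hu hv
      rw [← hG.dist_eq_zero_iff.1 hu, ← hG.dist_eq_zero_iff.1 hv]
    | succ d ih =>
      intro u v hu hv
      obtain ⟨w, hwu, hw⟩ := hpred d u hu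
      obtain ⟨w', hwv, hw'⟩ := hpred d v hv
      obtain rfl := ih w w' hw hw'
      cases d with
      | zero =>
        obtain rfl := hG.dist_eq_zero_iff.1 hw
        exact hr u v hwu hwv
      | succ d =>
        obtain ⟨z, hzw, hz⟩ := hpred d w hw
        obtain rfl | rfl | h := hdeg w z u v hzw.symm hwu hwv
        · omega
        · omega
        · exact h
  have hlt : ∀ u, G.dist r u < Fintype.card V := by
    intro u
    obtain ⟨q, hq, hlen⟩ := hG.exists_path_of_dist r u
    exact hlen ▸ hq.length_lt
  let f : V → Fin (Fintype.card V) := fun u => ⟨G.dist r u, hlt u⟩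
  have hf : Function.Bijective f := by
    rw [Fintype.bijective_iff_injective_and_card]
    exact ⟨fun u v huv => hinj _ u v rfl (Fin.mk.inj_iff.1 huv).symm, by simp⟩
  have hsucc : ∀ u v, G.dist r u + 1 = G.dist r v → G.Adj u v := by
    intro u v huv
    obtain ⟨w, hwv, hw⟩ := hpred _ v huv.symm
    rwa [hinj _ u w rfl hw]
  refine ⟨Fintype.card V, ⟨⟨Equiv.ofBijective f hf, ?_⟩⟩⟩
  intro u v
  simp only [Equiv.ofBijective_apply, SimpleGraph.pathGraph_adj, f]
  constructor
  · rintro (h | h)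
    · exact hsucc u v h
    · exact (hsucc v u h).symm
  · intro h
    have h1 := hG.dist_triangle (u := r) (v := u) (w := v)
    have h2 := hG.dist_triangle (u := r) (v := v) (w := u)
    rw [SimpleGraph.dist_eq_one_iff_adj.2 h] at h1
    rw [SimpleGraph.dist_eq_one_iff_adj.2 h.symm] at h2
    have h3 : G.dist r u ≠ G.dist r v := fun e => h.ne (hinj _ u v rfl e.symm)
    omega

/-! ### Branches of an acyclic graph -/

/-- The branch at `a` seen from `p`: the vertices that can be reached from `a` without visiting
`p`. It is used for adjacent `p` and `a`. -/
inductive Branch {V : Type*} (G : SimpleGraph V) (p a : V) : V → Prop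
  | root : Branch G p a a
  | step (u w : V) (hu : Branch G p a u) (huw : G.Adj u w) (hw : w ≠ p) : Branch G p a w

namespace Branch

variable {V : Type*} {G : SimpleGraph V} {p a b u w : V}

theorem ne (hpa : p ≠ a) (hu : Branch G p a u) : u ≠ p := by
  cases hu with
  | root => exact hpa.symm
  | step _ _ _ _ hw => exact hw

theorem trans (h1 : Branch G p a b) (h2 : Branch G p b u) : Branch G p a u := by
  induction h2 with
  | root => exact h1
  | step v w _ hvw hw ih => exact step v w ih hvw hw

theorem symm (hpa : p ≠ a) (h : Branch G p a u) : Branch G p u a := by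
  induction h with
  | root => exact root
  | step v w hv hvw hw ih => exact (step w v root hvw.symm (hv.ne hpa)).trans ih

theorem exists_walk (hpa : p ≠ a) (h : Branch G p a u) : ∃ q : G.Walk a u, p ∉ q.support := by
  induction h with
  | root => exact ⟨.nil, by simpa using hpa⟩
  | step v w hv hvw hw ih =>
    obtain ⟨q, hq⟩ := ih
    exact ⟨q.concat hvw, by simp [SimpleGraph.Walk.support_concat, hq, hw.symm]⟩

/-- The only neighbour of `p` in the branch at `a` is `a`. -/
theorem eq_of_adj (hG : G.IsAcyclic) (hpa : G.Adj p a) (h : Branch G p a u) (hu : G.Adj p u) :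
    u = a := by
  classical
  obtain ⟨q, hq⟩ := h.exists_walk hpa.ne
  have hq' : p ∉ q.bypass.support := fun hp => hq (q.support_bypass_subset_support hp)
  have h1 : (SimpleGraph.Walk.cons hpa q.bypass).IsPath := by
    rw [SimpleGraph.Walk.cons_isPath_iff]
    exact ⟨q.bypass_isPath, hq'⟩
  have h2 : (SimpleGraph.Walk.cons hu .nil).IsPath := by
    simp [SimpleGraph.Walk.cons_isPath_iff, hu.ne]
  have h3 := congrArg (fun q => q.1.length)
    ((hG.subsingleton_path p u).elim ⟨_, h1⟩ ⟨_, h2⟩)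
  simp only [SimpleGraph.Walk.length_cons, SimpleGraph.Walk.length_nil] at h3
  exact (SimpleGraph.Walk.eq_of_length_eq_zero (p := q.bypass) (by omega)).symm

theorem not_self (hpa : p ≠ a) : ¬ Branch G p a p := fun h => h.ne hpa rfl

theorem exists_of_ne (hpa : p ≠ a) (h : Branch G p a u) (hu : u ≠ a) :
    ∃ b, G.Adj a b ∧ b ≠ p ∧ Branch G a b u := by
  induction h with
  | root => exact absurd rfl hu
  | step v w hv hvw hw ih =>
    obtain rfl | hva := eq_or_ne v a
    · exact ⟨w, hvw, hw, root⟩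
    · obtain ⟨b, hab, hbp, hb⟩ := ih hva
      exact ⟨b, hab, hbp, step v w hb hvw hu⟩

theorem of_branch (hG : G.IsAcyclic) (hpa : G.Adj p a) (hab : G.Adj a b) (hbp : b ≠ p)
    (h : Branch G a b u) : Branch G p a u := by
  induction h with
  | root => exact step a b root hab hbp
  | step v w hv hvw hw ih =>
    refine step v w ih hvw ?_
    rintro rfl
    exact hv.ne hab.ne (ih.eq_of_adj hG hpa hvw.symm)

theorem root_unique (hG : G.IsAcyclic) (hpa : G.Adj p a) (hpb : G.Adj p b) (h1 : Branch G p a u)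
    (h2 : Branch G p b u) : a = b :=
  ((h1.trans (h2.symm hpb.ne)).eq_of_adj hG hpa hpb).symm

end Branch

/-! ### Minimal forts of a branch -/

/-- A minimal fort `X` of the branch at `a` seen from `p`, relative to that branch: it contains
`a`, no vertex of the branch outside `X` has exactly one neighbour in `X`, and the only subsets of
`X` with this last property are `∅` and `X`. -/
structure IsBranchFort {V : Type*} (G : SimpleGraph V) (p a : V) (X : Set V) : Prop where
  branch : ∀ u ∈ X, Branch G p a u
  mem : a ∈ X
  fort : IsFortOn G {u | Branch G p a u} X
  eq_or_eq : ∀ Y ⊆ X, IsFortOn G {u | Branch G p a u} Y → Y = ∅ ∨ Y = X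

/-- `IsContinuation G a h X`: the set `X` extends, beyond the neighbour `h` of `a`, a fort that
contains `a`. If `h` is a leaf it has to be in the fort itself; otherwise `h` is left out, and it
needs a second neighbour `e` in the fort, with which a branch fort starts. -/
def IsContinuation {V : Type*} (G : SimpleGraph V) (a h : V) (X : Set V) : Prop :=
  (IsLeafVertex G h ∧ X = {h}) ∨
    ∃ e, G.Adj h e ∧ e ≠ a ∧ ¬ IsLeafVertex G h ∧ IsBranchFort G h e X

section

variable {V : Type*} {G : SimpleGraph V} {p a b h u : V} {X Y : Set V}

theorem IsContinuation.branch (hG : G.IsAcyclic) (hah : G.Adj a h) (hX : IsContinuation G a h X) :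
    ∀ u ∈ X, Branch G a h u := by
  obtain ⟨_, rfl⟩ | ⟨e, hhe, hea, _, hX⟩ := hX
  · rintro u rfl
    exact .root
  · exact fun u hu => (hX.branch u hu).of_branch hG hah hhe hea

/-- The vertex `a` together with one continuation for every neighbour of `a` other than `p` is a
branch fort. If a sub-fort avoids `a`, it can only consist of leaves at `a`; there is at most one
of those, and then `a` has it as its only neighbour in the sub-fort. -/
theorem IsBranchFort.of_isContinuation (hG : G.IsAcyclic)
    (htw : ∀ p x y, G.Adj p x → G.Adj p y → IsLeafVertex G x → IsLeafVertex G y → x = y)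
    (hpa : G.Adj p a) {X : V → Set V}
    (hX : ∀ h, G.Adj a h → h ≠ p → IsContinuation G a h (X h)) :
    IsBranchFort G p a (insert a {u | ∃ h, G.Adj a h ∧ h ≠ p ∧ u ∈ X h}) := by
  set U : Set V := insert a {u | ∃ h, G.Adj a h ∧ h ≠ p ∧ u ∈ X h} with hU
  have hsub : ∀ h, G.Adj a h → h ≠ p → ∀ u ∈ X h, Branch G a h u :=
    fun h hah hhp => (hX h hah hhp).branch hG hah
  have hkey : ∀ h, G.Adj a h → h ≠ p → ∀ u ∈ U, Branch G a h u → u ∈ X h := by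
    rintro h hah hhp u (rfl | ⟨h', hah', hhp', hu'⟩) hu
    · exact absurd hu (Branch.not_self hah.ne)
    · obtain rfl := (hsub h' hah' hhp' u hu').root_unique hG hah' hah hu
      exact hu'
  have hnbr : ∀ h, G.Adj a h → ∀ u, Branch G a h u → ∀ x, G.Adj u x → x ≠ a → Branch G a h x :=
    fun h _ u hu x hux hxa => Branch.step u x hu hux hxa
  refine ⟨?_, Or.inl rfl, ?_, ?_⟩
  · rintro u (rfl | ⟨h, hah, hhp, hu⟩)
    · exact .root
    · exact (hsub h hah hhp u hu).of_branch hG hpa hah hhp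
  · intro u hu huU x hx hux
    have hua : u ≠ a := fun e => huU (e ▸ Or.inl rfl)
    obtain ⟨h, hah, hhp, hu⟩ := Branch.exists_of_ne hpa.ne hu hua
    obtain ⟨hleaf, hXh⟩ | ⟨e, hhe, hea, _, hXh⟩ := hX h hah hhp
    · exfalso
      have huh : u ≠ h := by
        rintro rfl
        exact huU (Or.inr ⟨u, hah, hhp, by simp [hXh]⟩)
      obtain ⟨b, hhb, hba, _⟩ := Branch.exists_of_ne hah.ne hu huh
      exact hba (hleaf b a hhb hah.symm)
    · obtain rfl | huh := eq_or_ne u h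
      · obtain rfl | hxa := eq_or_ne x a
        · exact ⟨e, Or.inr ⟨u, hah, hhp, hXh.mem⟩, hea, hhe⟩
        · exact ⟨a, Or.inl rfl, hxa.symm, hah.symm⟩
      · have hxa : x ≠ a := by
          rintro rfl
          exact huh (hu.eq_of_adj hG hah hux.symm)
        have hxX := hkey h hah hhp x hx (hnbr h hah u hu x hux hxa)
        have hue := Branch.step x u (hXh.branch x hxX) hux.symm huh
        obtain ⟨y, hy, hyx, huy⟩ :=
          hXh.fort u hue (fun hu => huU (Or.inr ⟨h, hah, hhp, hu⟩)) x hxX hux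
        exact ⟨y, Or.inr ⟨h, hah, hhp, hy⟩, hyx, huy⟩
  · intro Y hYU hY
    have hnot : ∀ h e, G.Adj a h → h ≠ p → G.Adj h e → IsBranchFort G h e (X h) → h ∉ U := by
      intro h e hah hhp hhe hXh hhU
      exact Branch.not_self hhe.ne (hXh.branch h (hkey h hah hhp h hhU .root))
    have hpiece : ∀ h e, G.Adj a h → h ≠ p → G.Adj h e → e ≠ a → IsBranchFort G h e (X h) →
        Y ∩ X h = ∅ ∨ Y ∩ X h = X h := by
      intro h e hah hhp hhe hea hXh
      refine hXh.eq_or_eq _ Set.inter_subset_right ?_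
      intro u hu huY x hx hux
      have hu' : Branch G a h u := Branch.of_branch hG hah hhe hea hu
      obtain ⟨y, hyY, hyx, huy⟩ := hY u (hu'.of_branch hG hpa hah hhp)
        (fun huY' => huY ⟨huY', hkey h hah hhp u (hYU huY') hu'⟩) x hx.1 hux
      have hyh : y ≠ h := by
        rintro rfl
        exact hnot y e hah hhp hhe hXh (hYU hyY)
      have hy : Branch G h e y := Branch.step u y hu huy hyh
      exact ⟨y, ⟨hyY, hkey h hah hhp y (hYU hyY) (hy.of_branch hG hah hhe hea)⟩, hyx, huy⟩
    have hbranch : ∀ h, G.Adj a h → h ≠ p → Branch G p a h :=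
      fun h hah hhp => Branch.step a h .root hah hhp
    by_cases haY : a ∈ Y
    · right
      refine hYU.antisymm ?_
      rintro u (rfl | ⟨h, hah, hhp, hu⟩)
      · exact haY
      obtain ⟨hleaf, hXh⟩ | ⟨e, hhe, hea, _, hXh⟩ := hX h hah hhp
      · obtain rfl : u = h := by simpa [hXh] using hu
        by_contra huY
        obtain ⟨y, _, hya, huy⟩ := hY u (hbranch u hah hhp) huY a haY hah.symm
        exact hya (hleaf y a huy hah.symm)
      · obtain ⟨y, hyY, hya, hhy⟩ := hY h (hbranch h hah hhp)
          (fun hhY => hnot h e hah hhp hhe hXh (hYU hhY)) a haY hah.symm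
        have hyX := hkey h hah hhp y (hYU hyY) (hnbr h hah h .root y hhy hya)
        obtain h0 | h1 := hpiece h e hah hhp hhe hea hXh
        · exact absurd h0 (Set.Nonempty.ne_empty ⟨y, hyY, hyX⟩)
        · exact (h1.symm ▸ hu : u ∈ Y ∩ X h).1
    · left
      refine Set.eq_empty_iff_forall_notMem.2 fun u huY => ?_
      obtain rfl | ⟨h, hah, hhp, hu⟩ := hYU huY
      · exact haY huY
      obtain ⟨hleaf, hXh⟩ | ⟨e, hhe, hea, _, hXh⟩ := hX h hah hhp
      · obtain rfl : u = h := by simpa [hXh] using hu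
        obtain ⟨y, hyY, hyu, hay⟩ := hY a .root haY u huY hah
        obtain rfl | ⟨h', hah', hhp', hy⟩ := hYU hyY
        · exact haY hyY
        obtain rfl := (hsub h' hah' hhp' y hy).eq_of_adj hG hah' hay
        obtain ⟨hleaf', _⟩ | ⟨e', hhe', _, _, hXh'⟩ := hX y hah' hhp'
        · exact hyu (htw a y u hay hah hleaf' hleaf)
        · exact hnot y e' hay hhp' hhe' hXh' (hYU hyY)
      · obtain h0 | h1 := hpiece h e hah hhp hhe hea hXh
        · exact Set.eq_empty_iff_forall_notMem.1 h0 u ⟨huY, hu⟩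
        · have heY : e ∈ Y := (h1.symm ▸ hXh.mem : e ∈ Y ∩ X h).1
          obtain ⟨y, hyY, hye, hhy⟩ := hY h (hbranch h hah hhp)
            (fun hhY => hnot h e hah hhp hhe hXh (hYU hhY)) e heY hhe
          have hya : y ≠ a := fun e => haY (e ▸ hyY)
          have hyX := hkey h hah hhp y (hYU hyY) (hnbr h hah h .root y hhy hya)
          exact hye ((hXh.branch y hyX).eq_of_adj hG hhe hhy)

theorem exists_isContinuation_of_forall
    (hex : ∀ e, G.Adj h e → e ≠ a → ∃ X, IsBranchFort G h e X) :
    ∃ X, IsContinuation G a h X := by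
  by_cases hleaf : IsLeafVertex G h
  · exact ⟨{h}, Or.inl ⟨hleaf, rfl⟩⟩
  · have hleaf' := hleaf
    simp only [IsLeafVertex] at hleaf'
    push Not at hleaf'
    obtain ⟨y, z, hy, hz, hyz⟩ := hleaf'
    obtain ⟨e, hhe, hea⟩ : ∃ e, G.Adj h e ∧ e ≠ a := by
      by_cases hya : y = a
      · exact ⟨z, hz, fun hza => hyz (hya.trans hza.symm)⟩
      · exact ⟨y, hy, hya⟩
    obtain ⟨X, hX⟩ := hex e hhe hea
    exact ⟨X, Or.inr ⟨e, hhe, hea, hleaf, hX⟩⟩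

theorem exists_isBranchFort [Finite V] (hG : G.IsAcyclic)
    (htw : ∀ p x y, G.Adj p x → G.Adj p y → IsLeafVertex G x → IsLeafVertex G y → x = y)
    (hpa : G.Adj p a) : ∃ X, IsBranchFort G p a X := by
  induction hn : {u | Branch G p a u}.ncard using Nat.strong_induction_on generalizing p a with
  | _ n ih =>
    have hcont : ∀ h, G.Adj a h → h ≠ p → ∃ X, IsContinuation G a h X := by
      intro h hah hhp
      refine exists_isContinuation_of_forall fun e hhe hea => ?_
      refine ih _ ?_ hhe rfl
      rw [← hn]
      refine Set.ncard_lt_ncard ⟨fun u hu => ?_, fun hsub => ?_⟩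
      · exact (Branch.of_branch hG hah hhe hea hu).of_branch hG hpa hah hhp
      · exact Branch.not_self hah.ne (Branch.of_branch hG hah hhe hea (hsub Branch.root))
    choose! X hX using hcont
    exact ⟨_, IsBranchFort.of_isContinuation hG htw hpa hX⟩

theorem exists_isContinuation [Finite V] (hG : G.IsAcyclic)
    (htw : ∀ p x y, G.Adj p x → G.Adj p y → IsLeafVertex G x → IsLeafVertex G y → x = y)
    (a h : V) : ∃ X, IsContinuation G a h X :=
  exists_isContinuation_of_forall fun _ hhe _ => exists_isBranchFort hG htw hhe

theorem IsBranchFort.disjoint (hG : G.IsAcyclic) (hpa : G.Adj p a) (hpb : G.Adj p b) (hab : a ≠ b)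
    (hX : IsBranchFort G p a X) (hY : IsBranchFort G p b Y) : Disjoint X Y :=
  Set.disjoint_left.2 fun u hu hu' =>
    hab ((hX.branch u hu).root_unique hG hpa hpb (hY.branch u hu'))

/-- Restriction of a fort in the union of two branch forts at `p` to one of them. -/
theorem IsBranchFort.inter_eq (hG : G.IsAcyclic) (hpa : G.Adj p a) (hpb : G.Adj p b) (hab : a ≠ b)
    (hX : IsBranchFort G p a X) (hY : IsBranchFort G p b Y) {F : Set V} (hF : IsFort G F)
    (hsub : F ⊆ X ∪ Y) : F ∩ X = ∅ ∨ F ∩ X = X := by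
  have hmem : ∀ u ∈ F, Branch G p a u → u ∈ X := by
    intro u hu hb
    refine (hsub hu).resolve_right fun huY => ?_
    exact hab (hb.root_unique hG hpa hpb (hY.branch u huY))
  refine hX.eq_or_eq _ Set.inter_subset_right fun u hu huF x hx hux => ?_
  obtain ⟨y, hyF, hyx, huy⟩ :=
    hF.2 u trivial (fun h => huF ⟨h, hmem u h hu⟩) x hx.1 hux
  have hyp : y ≠ p := by
    rintro rfl
    obtain h | h := hsub hyF
    · exact Branch.not_self hpa.ne (hX.branch _ h)
    · exact Branch.not_self hpb.ne (hY.branch _ h)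
  exact ⟨y, ⟨hyF, hmem y hyF (Branch.step u y hu huy hyp)⟩, hyx, huy⟩

/-- Branch forts at two neighbours of `p` are linked by `p` into a minimal fort. -/
theorem IsBranchFort.minimal_isFort_union (hG : G.IsAcyclic) (hpa : G.Adj p a) (hpb : G.Adj p b)
    (hab : a ≠ b) (hX : IsBranchFort G p a X) (hY : IsBranchFort G p b Y) :
    Minimal (IsFort G) (X ∪ Y) := by
  have hpXY : p ∉ X ∪ Y := by
    rintro (h | h)
    · exact Branch.not_self hpa.ne (hX.branch _ h)
    · exact Branch.not_self hpb.ne (hY.branch _ h)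
  refine ⟨⟨⟨a, Or.inl hX.mem⟩, fun u _ hu x hx hux => ?_⟩, fun F hF hsub => ?_⟩
  · obtain rfl | hup := eq_or_ne u p
    · obtain rfl | hxa := eq_or_ne x a
      · exact ⟨b, Or.inr hY.mem, hab.symm, hpb⟩
      · exact ⟨a, Or.inl hX.mem, hxa.symm, hpa⟩
    · obtain hx | hx := hx
      · obtain ⟨y, hy, hyx, huy⟩ := hX.fort u (Branch.step x u (hX.branch x hx) hux.symm hup)
          (fun h => hu (Or.inl h)) x hx hux
        exact ⟨y, Or.inl hy, hyx, huy⟩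
      · obtain ⟨y, hy, hyx, huy⟩ := hY.fort u (Branch.step x u (hY.branch x hx) hux.symm hup)
          (fun h => hu (Or.inr h)) x hx hux
        exact ⟨y, Or.inr hy, hyx, huy⟩
  · have hpF : p ∉ F := fun h => hpXY (hsub h)
    have hcross : a ∈ F ↔ b ∈ F := by
      constructor
      · intro ha
        obtain ⟨y, hyF, hya, hpy⟩ := hF.2 p trivial hpF a ha hpa
        obtain h | h := hsub hyF
        · exact absurd ((hX.branch y h).eq_of_adj hG hpa hpy) hya
        · exact (hY.branch y h).eq_of_adj hG hpb hpy ▸ hyF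
      · intro hb
        obtain ⟨y, hyF, hyb, hpy⟩ := hF.2 p trivial hpF b hb hpb
        obtain h | h := hsub hyF
        · exact (hX.branch y h).eq_of_adj hG hpa hpy ▸ hyF
        · exact absurd ((hY.branch y h).eq_of_adj hG hpb hpy) hyb
    obtain hX0 | hX1 := hX.inter_eq hG hpa hpb hab hY hF hsub <;>
      obtain hY0 | hY1 := hY.inter_eq hG hpb hpa hab.symm hX hF (Set.union_comm X Y ▸ hsub)
    · exfalso
      obtain ⟨u, hu⟩ := hF.1
      obtain h | h := hsub hu
      · exact Set.eq_empty_iff_forall_notMem.1 hX0 u ⟨hu, h⟩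
      · exact Set.eq_empty_iff_forall_notMem.1 hY0 u ⟨hu, h⟩
    · exfalso
      have hb : b ∈ F := (hY1.symm ▸ hY.mem : b ∈ F ∩ Y).1
      exact Set.eq_empty_iff_forall_notMem.1 hX0 a ⟨hcross.2 hb, hX.mem⟩
    · exfalso
      have ha : a ∈ F := (hX1.symm ▸ hX.mem : a ∈ F ∩ X).1
      exact Set.eq_empty_iff_forall_notMem.1 hY0 b ⟨hcross.1 ha, hY.mem⟩
    · rintro u (hu | hu)
      · exact (hX1.symm ▸ hu : u ∈ F ∩ X).1
      · exact (hY1.symm ▸ hu : u ∈ F ∩ Y).1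

end

/-! ### The equations between the sizes of continuations -/

open Classical in
/-- The relations that hold for the size `s a h` of a continuation of `a` through its neighbour `h`
in a graph without twin leaves, all of whose minimal forts have `k` elements. -/
structure IsContinuationSize {V : Type*} [Fintype V] (G : SimpleGraph V) (k : ℕ)
    (s : V → V → ℕ) : Prop where
  pos : ∀ a h, G.Adj a h → 1 ≤ s a h
  leaf : ∀ a h, IsLeafVertex G h → s a h = 1
  pair : ∀ p a b, G.Adj p a → G.Adj p b → a ≠ b → s a p + s b p = k
  sum : ∀ v p, G.Adj v p → ¬ IsLeafVertex G p → (∑ h with G.Adj v h, s v h) + 1 = k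

section

variable {V : Type*} {G : SimpleGraph V}

open Classical in
theorem ncard_insert_iUnion_continuation [Fintype V] (hG : G.IsAcyclic) {X : V → Set V} {p a : V}
    (hX : ∀ h, G.Adj a h → h ≠ p → IsContinuation G a h (X h)) :
    (insert a {u | ∃ h, G.Adj a h ∧ h ≠ p ∧ u ∈ X h}).ncard
      = (∑ h with G.Adj a h ∧ h ≠ p, (X h).ncard) + 1 := by
  have heq : {u | ∃ h, G.Adj a h ∧ h ≠ p ∧ u ∈ X h}
      = (((Finset.univ.filter fun h => G.Adj a h ∧ h ≠ p).biUnion fun h => (X h).toFinset :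
        Finset V) : Set V) := by
    ext u
    simp [and_assoc]
  rw [Set.ncard_insert_of_notMem, heq, Set.ncard_coe_finset, Finset.card_biUnion]
  · simp [Set.ncard_eq_toFinset_card']
  · intro h hh h' hh' hne
    simp only [Finset.mem_coe, Finset.mem_filter, Finset.mem_univ, true_and] at hh hh'
    refine Set.disjoint_toFinset.2 (Set.disjoint_left.2 ?_)
    intro u hu hu'
    exact hne (((hX h hh.1 hh.2).branch hG hh.1 u hu).root_unique hG hh.1 hh'.1
      ((hX h' hh'.1 hh'.2).branch hG hh'.1 u hu'))
  · rintro ⟨h, hah, hhp, hu⟩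
    exact Branch.not_self hah.ne ((hX h hah hhp).branch hG hah a hu)

theorem exists_isContinuationSize [Fintype V] (hG : G.IsAcyclic)
    (htw : ∀ p x y, G.Adj p x → G.Adj p y → IsLeafVertex G x → IsLeafVertex G y → x = y)
    {k : ℕ} (hk : ∀ F, Minimal (IsFort G) F → F.ncard = k) :
    ∃ s, IsContinuationSize G k s := by
  classical
  choose X hX using fun a h => exists_isContinuation (a := a) (h := h) hG htw
  have hlink : ∀ p a b A B, G.Adj p a → G.Adj p b → a ≠ b → IsBranchFort G p a A →
      IsBranchFort G p b B → A.ncard + B.ncard = k := by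
    intro p a b A B hpa hpb hab hA hB
    rw [← Set.ncard_union_eq (hA.disjoint hG hpa hpb hab hB)]
    exact hk _ (hA.minimal_isFort_union hG hpa hpb hab hB)
  have hjoin : ∀ p a, G.Adj p a → ∃ W, IsBranchFort G p a W ∧
      W.ncard = (∑ h with G.Adj a h ∧ h ≠ p, (X a h).ncard) + 1 := fun p a hpa =>
    ⟨_, IsBranchFort.of_isContinuation hG htw hpa (X := X a) fun h _ _ => hX a h,
      ncard_insert_iUnion_continuation hG fun h _ _ => hX a h⟩
  have hcont : ∀ p a W, G.Adj p a → ¬ IsLeafVertex G p → IsBranchFort G p a W →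
      W.ncard + (X a p).ncard = k := by
    intro p a W hpa hp hW
    obtain ⟨h, _⟩ | ⟨e, hpe, hea, _, hXe⟩ := hX a p
    · exact absurd h hp
    · exact hlink p a e W _ hpa hpe hea.symm hW hXe
  refine ⟨fun a h => (X a h).ncard, ?_, ?_, ?_, ?_⟩
  · intro a h _
    rw [Nat.one_le_iff_ne_zero, Ne, Set.ncard_eq_zero]
    obtain ⟨_, h⟩ | ⟨e, _, _, _, hXe⟩ := hX a h
    · simp [h]
    · exact Set.Nonempty.ne_empty ⟨e, hXe.mem⟩
  · intro a h hh
    obtain ⟨_, h⟩ | ⟨_, _, _, h, _⟩ := hX a h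
    · simp [h]
    · exact absurd hh h
  · intro p a b hpa hpb hab
    have hp : ¬ IsLeafVertex G p := fun h => hab (h a b hpa hpb)
    obtain ⟨A, hA, _⟩ := hjoin p a hpa
    obtain ⟨B, hB, _⟩ := hjoin p b hpb
    have h1 := hlink p a b A B hpa hpb hab hA hB
    have h2 := hcont p a A hpa hp hA
    have h3 := hcont p b B hpb hp hB
    omega
  · intro v p hvp hp
    obtain ⟨W, hW, hcard⟩ := hjoin p v hvp.symm
    have h1 := hcont p v W hvp.symm hp hW
    have h2 : (Finset.univ.filter fun h => G.Adj v h)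
        = insert p (Finset.univ.filter fun h => G.Adj v h ∧ h ≠ p) := by
      ext h
      simp only [Finset.mem_filter, Finset.mem_univ, true_and, Finset.mem_insert]
      constructor
      · intro hh
        by_cases hhp : h = p
        · exact Or.inl hhp
        · exact Or.inr ⟨hh, hhp⟩
      · rintro (rfl | hh)
        · exact hvp
        · exact hh.1
    rw [h2, Finset.sum_insert (by simp)]
    omega

theorem exists_adj_ne_of_not_isLeafVertex {z : V} (hz : ¬ IsLeafVertex G z) (y : V) :
    ∃ w, G.Adj z w ∧ w ≠ y := by
  by_contra h
  push Not at h
  exact hz fun a b ha hb => (h a ha).trans (h b hb).symm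

namespace IsContinuationSize

variable [Fintype V] {k : ℕ} {s : V → V → ℕ}

theorem two_mul_eq (hs : IsContinuationSize G k s) {p a b c : V} (ha : G.Adj p a)
    (hb : G.Adj p b) (hc : G.Adj p c) (hab : a ≠ b) (hac : a ≠ c) (hbc : b ≠ c) :
    2 * s a p = k := by
  have h1 := hs.pair p a b ha hb hab
  have h2 := hs.pair p a c ha hc hac
  have h3 := hs.pair p b c hb hc hbc
  omega

/-- The sum relation at a vertex of degree two; the hypothesis `hne` excludes a larger degree. -/
theorem sum_pair (hs : IsContinuationSize G k s) {z y w : V} (hzy : G.Adj z y)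
    (hy : ¬ IsLeafVertex G y) (hzw : G.Adj z w) (hwy : w ≠ y) (hne : 2 * s y z ≠ k) :
    s z y + s z w + 1 = k := by
  classical
  have h := hs.sum z y hzy hy
  have heq : (Finset.univ.filter fun h => G.Adj z h) = {y, w} := by
    ext u
    simp only [Finset.mem_filter, Finset.mem_univ, true_and, Finset.mem_insert,
      Finset.mem_singleton]
    constructor
    · intro hzu
      by_contra hu
      push Not at hu
      exact hne (hs.two_mul_eq hzy hzw hzu hwy.symm hu.1.symm hu.2.symm)
    · rintro (rfl | rfl)
      · exact hzy
      · exact hzw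
  rw [← h]
  convert rfl
  rw [← Finset.sum_pair (f := s z) hwy.symm, ← heq]

theorem add_one_eq (hs : IsContinuationSize G k s) {w z : V} (hw : IsLeafVertex G w)
    (hwz : G.Adj w z) (hz : ¬ IsLeafVertex G z) : s w z + 1 = k := by
  classical
  have h := hs.sum w z hwz hz
  have heq : (Finset.univ.filter fun h => G.Adj w h) = {z} := by
    ext u
    simp only [Finset.mem_filter, Finset.mem_univ, true_and, Finset.mem_singleton]
    exact ⟨fun hu => hw u z hu hwz, fun hu => hu ▸ hwz⟩
  rw [← h]
  convert rfl
  rw [← Finset.sum_singleton (s w) z, ← heq]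

/-- Going along a path whose inner vertices have degree two, the values of `s` two steps apart
drop by one. A path on which they start with `s x y < s y z` and `2 * s y z < k` can never stop:
at a vertex of degree at least three the value would be `k / 2`, and at a leaf the last two values
would be `1`. -/
theorem not_lt_and_lt (hs : IsContinuationSize G k s) {x y z : V} (hxy : G.Adj x y)
    (hyz : G.Adj y z) (hxz : x ≠ z) (h1 : s x y < s y z) (h2 : 2 * s y z < k) : False := by
  induction hn : s x y using Nat.strong_induction_on generalizing x y z with
  | _ n ih =>
    have hpos := hs.pos x y hxy
    have hy : ¬ IsLeafVertex G y := fun h => hxz (h x z hxy.symm hyz)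
    have hz : ¬ IsLeafVertex G z := fun h => by
      have := hs.leaf y z h
      omega
    obtain ⟨w, hzw, hwy⟩ := exists_adj_ne_of_not_isLeafVertex hz y
    have e1 := hs.sum_pair hyz.symm hy hzw hwy (by omega)
    have e2 := hs.pair y x z hxy.symm hyz hxz
    have e3 := hs.pair z y w hyz.symm hzw hwy.symm
    have hw : ¬ IsLeafVertex G w := fun h => by
      have := hs.add_one_eq h hzw.symm hz
      omega
    obtain ⟨u, hwu, huz⟩ := exists_adj_ne_of_not_isLeafVertex hw z
    have e4 := hs.sum_pair hzw.symm hz hwu huz (by omega)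
    exact ih (s z w) (by omega) hzw hwu huz.symm (by omega) (by omega) rfl

theorem sum_le (hs : IsContinuationSize G k s) {v p : V} (hvp : G.Adj v p)
    (hp : ¬ IsLeafVertex G p) {A : Finset V} (hA : ∀ h ∈ A, G.Adj v h) :
    (∑ h ∈ A, s v h) + 1 ≤ k := by
  classical
  rw [← hs.sum v p hvp hp]
  exact Nat.succ_le_succ (Finset.sum_le_sum_of_subset fun h hh => by simpa using hA h hh)

end IsContinuationSize

/-! ### A vertex of degree at least three -/

theorem nonempty_iso_star222 (hG : G.Connected) {v f₁ f₂ f₃ g₁ g₂ g₃ : V}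
    (h₁₂ : f₁ ≠ f₂) (h₁₃ : f₁ ≠ f₃) (h₂₃ : f₂ ≠ f₃) (hg₁ : g₁ ≠ v) (hg₂ : g₂ ≠ v) (hg₃ : g₃ ≠ v)
    (hv : ∀ u, G.Adj v u ↔ u = f₁ ∨ u = f₂ ∨ u = f₃)
    (hf₁ : ∀ u, G.Adj f₁ u ↔ u = v ∨ u = g₁) (hf₂ : ∀ u, G.Adj f₂ u ↔ u = v ∨ u = g₂)
    (hf₃ : ∀ u, G.Adj f₃ u ↔ u = v ∨ u = g₃) (hgf₁ : ∀ u, G.Adj g₁ u ↔ u = f₁)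
    (hgf₂ : ∀ u, G.Adj g₂ u ↔ u = f₂) (hgf₃ : ∀ u, G.Adj g₃ u ↔ u = f₃) :
    Nonempty (G ≃g star222) := by
  have hvf : ∀ u, u = f₁ ∨ u = f₂ ∨ u = f₃ → v ≠ u := fun u hu => ((hv u).2 hu).ne
  have hfv₁ := hvf f₁ (by simp)
  have hfv₂ := hvf f₂ (by simp)
  have hfv₃ := hvf f₃ (by simp)
  -- Each `fᵢ` is adjacent to `v`, whereas the only neighbour of `gⱼ` is `fⱼ ≠ v`.
  have hgf : ∀ g f, (∀ u, G.Adj g u ↔ u = f) → v ≠ f → ∀ f', G.Adj f' v → g ≠ f' := by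
    rintro g f hgf hvf f' hf' rfl
    exact hvf ((hgf v).1 hf')
  have hgg : ∀ g g' f f', (∀ u, G.Adj g u ↔ u = f) → (∀ u, G.Adj g' u ↔ u = f') → f ≠ f' →
      g ≠ g' := by
    rintro g g' f f' hg hg' hne rfl
    exact hne ((hg' f).1 ((hg f).2 rfl))
  have hfa₁ : G.Adj f₁ v := (hf₁ v).2 (by simp)
  have hfa₂ : G.Adj f₂ v := (hf₂ v).2 (by simp)
  have hfa₃ : G.Adj f₃ v := (hf₃ v).2 (by simp)
  have d11 := hgf g₁ f₁ hgf₁ hfv₁ f₁ hfa₁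
  have d12 := hgf g₁ f₁ hgf₁ hfv₁ f₂ hfa₂
  have d13 := hgf g₁ f₁ hgf₁ hfv₁ f₃ hfa₃
  have d21 := hgf g₂ f₂ hgf₂ hfv₂ f₁ hfa₁
  have d22 := hgf g₂ f₂ hgf₂ hfv₂ f₂ hfa₂
  have d23 := hgf g₂ f₂ hgf₂ hfv₂ f₃ hfa₃
  have d31 := hgf g₃ f₃ hgf₃ hfv₃ f₁ hfa₁
  have d32 := hgf g₃ f₃ hgf₃ hfv₃ f₂ hfa₂
  have d33 := hgf g₃ f₃ hgf₃ hfv₃ f₃ hfa₃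
  have e12 := hgg g₁ g₂ f₁ f₂ hgf₁ hgf₂ h₁₂
  have e13 := hgg g₁ g₃ f₁ f₃ hgf₁ hgf₃ h₁₃
  have e23 := hgg g₂ g₃ f₂ f₃ hgf₂ hgf₃ h₂₃
  let φ : Fin 7 → V := ![v, f₁, f₂, f₃, g₁, g₂, g₃]
  have hinj : Function.Injective φ := by
    intro i j hij
    fin_cases i <;> fin_cases j <;>
      first
      | rfl
      | exact absurd hij (by assumption)
      | exact absurd hij.symm (by assumption)
  have hsurj : Function.Surjective φ := by
    refine hG.mem_of_forall_adj (S := Set.range φ) (v := v) ⟨0, rfl⟩ ?_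
    rintro _ ⟨i, rfl⟩ w hw
    fin_cases i
    · obtain rfl | rfl | rfl := (hv w).1 hw
      exacts [⟨1, rfl⟩, ⟨2, rfl⟩, ⟨3, rfl⟩]
    · obtain rfl | rfl := (hf₁ w).1 hw
      exacts [⟨0, rfl⟩, ⟨4, rfl⟩]
    · obtain rfl | rfl := (hf₂ w).1 hw
      exacts [⟨0, rfl⟩, ⟨5, rfl⟩]
    · obtain rfl | rfl := (hf₃ w).1 hw
      exacts [⟨0, rfl⟩, ⟨6, rfl⟩]
    · exact ⟨1, ((hgf₁ w).1 hw).symm⟩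
    · exact ⟨2, ((hgf₂ w).1 hw).symm⟩
    · exact ⟨3, ((hgf₃ w).1 hw).symm⟩
  refine ⟨RelIso.symm ⟨Equiv.ofBijective φ ⟨hinj, hsurj⟩, ?_⟩⟩
  intro i j
  have hrow : ∀ j, G.Adj (φ i) (φ j) ↔ star222.Adj i j := by
    intro j
    fin_cases i
    · refine (hv _).trans ?_
      rw [show f₁ = φ 1 from rfl, show f₂ = φ 2 from rfl, show f₃ = φ 3 from rfl,
        hinj.eq_iff, hinj.eq_iff, hinj.eq_iff]
      fin_cases j <;> simp [star222]
    · refine (hf₁ _).trans ?_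
      rw [show v = φ 0 from rfl, show g₁ = φ 4 from rfl, hinj.eq_iff, hinj.eq_iff]
      fin_cases j <;> simp [star222]
    · refine (hf₂ _).trans ?_
      rw [show v = φ 0 from rfl, show g₂ = φ 5 from rfl, hinj.eq_iff, hinj.eq_iff]
      fin_cases j <;> simp [star222]
    · refine (hf₃ _).trans ?_
      rw [show v = φ 0 from rfl, show g₃ = φ 6 from rfl, hinj.eq_iff, hinj.eq_iff]
      fin_cases j <;> simp [star222]
    · refine (hgf₁ _).trans ?_
      rw [show f₁ = φ 1 from rfl, hinj.eq_iff]
      fin_cases j <;> simp [star222]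
    · refine (hgf₂ _).trans ?_
      rw [show f₂ = φ 2 from rfl, hinj.eq_iff]
      fin_cases j <;> simp [star222]
    · refine (hgf₃ _).trans ?_
      rw [show f₃ = φ 3 from rfl, hinj.eq_iff]
      fin_cases j <;> simp [star222]
  exact hrow j

/-- Every value `s v f` at a vertex `v` of degree at least three is at least `k / 2 - 1`. As these
values have sum `k - 1`, this leaves only `k = 4` and three neighbours with value `1`. -/
theorem IsContinuationSize.nonempty_iso_star222 [Fintype V] (hG : G.Connected)
    (htw : ∀ p x y, G.Adj p x → G.Adj p y → IsLeafVertex G x → IsLeafVertex G y → x = y)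
    {k : ℕ} {s : V → V → ℕ} (hs : IsContinuationSize G k s) {v a b c : V}
    (ha : G.Adj v a) (hb : G.Adj v b) (hc : G.Adj v c) (hab : a ≠ b) (hac : a ≠ c) (hbc : b ≠ c) :
    Nonempty (G ≃g star222) := by
  classical
  have hv : ¬ IsLeafVertex G v := fun h => hab (h a b ha hb)
  obtain ⟨p, hvp, hp⟩ : ∃ p, G.Adj v p ∧ ¬ IsLeafVertex G p := by
    by_cases hal : IsLeafVertex G a
    · exact ⟨b, hb, fun hbl => hab (htw v a b ha hb hal hbl)⟩
    · exact ⟨a, ha, hal⟩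
  have hsum : s v a + s v b + s v c + 1 ≤ k := by
    have := hs.sum_le hvp hp (A := {a, b, c}) (by simp [ha, hb, hc])
    rwa [Finset.sum_insert (by simp [hab, hac]), Finset.sum_pair hbc, ← add_assoc] at this
  have hpa := hs.pos v a ha
  have hpb := hs.pos v b hb
  have hpc := hs.pos v c hc
  have hhalf : ∀ f, G.Adj v f → 2 * s f v = k := by
    intro f hf
    by_cases hfa : f = a
    · exact hs.two_mul_eq hf hb hc (hfa ▸ hab) (hfa ▸ hac) hbc
    · by_cases hfb : f = b
      · exact hs.two_mul_eq hf ha hc hfa (hfb ▸ hbc) hac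
      · exact hs.two_mul_eq hf ha hb hfa hfb hab
  have hnl : ∀ f, G.Adj v f → ¬ IsLeafVertex G f := by
    intro f hf hl
    have h1 := hs.add_one_eq hl hf.symm hv
    have h2 := hhalf f hf
    omega
  have hbound : ∀ f, G.Adj v f → k ≤ 2 * s v f + 2 := by
    intro f hf
    obtain ⟨g, hfg, hgv⟩ := exists_adj_ne_of_not_isLeafVertex (hnl f hf) v
    by_contra hlt
    have h1 := hs.sum_pair hf.symm hv hfg hgv (by omega)
    have h2 := hhalf f hf
    exact hs.not_lt_and_lt hf hfg hgv.symm (by omega) (by omega)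
  have hba := hbound a ha
  have hbb := hbound b hb
  have hbc' := hbound c hc
  obtain rfl : k = 4 := by
    have := hhalf a ha
    omega
  have hNv : ∀ u, G.Adj v u ↔ u = a ∨ u = b ∨ u = c := by
    refine fun u => ⟨fun hu => ?_, by rintro (rfl | rfl | rfl) <;> assumption⟩
    by_contra hne
    push Not at hne
    have h1 := hs.sum_le hvp hp (A := {u, a, b, c}) (by simp [hu, ha, hb, hc])
    rw [Finset.sum_insert (by simp [hne]), Finset.sum_insert (by simp [hab, hac]),
      Finset.sum_pair hbc] at h1
    have := hs.pos v u hu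
    omega
  have hleg : ∀ f, G.Adj v f → s v f = 1 → ∃ g, g ≠ v ∧ (∀ u, G.Adj f u ↔ u = v ∨ u = g) ∧
      ∀ u, G.Adj g u ↔ u = f := by
    intro f hf hone
    obtain ⟨g, hfg, hgv⟩ := exists_adj_ne_of_not_isLeafVertex (hnl f hf) v
    refine ⟨g, hgv, fun u => ⟨fun hu => ?_, ?_⟩, fun u => ⟨fun hu => ?_, ?_⟩⟩
    · by_contra hne
      push Not at hne
      have := hs.two_mul_eq hf.symm hfg hu hgv.symm hne.1.symm hne.2.symm
      omega
    · rintro (rfl | rfl)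
      · exact hf.symm
      · exact hfg
    · by_contra hne
      have h1 := hs.sum_le hfg.symm (hnl f hf) (A := {u, f}) (by simp [hu, hfg.symm])
      rw [Finset.sum_pair hne] at h1
      have h2 := hs.pos g u hu
      have h3 := hs.pair f v g hf.symm hfg hgv.symm
      omega
    · rintro rfl
      exact hfg.symm
  obtain ⟨g₁, hg₁, hf₁, hgf₁⟩ := hleg a ha (by omega)
  obtain ⟨g₂, hg₂, hf₂, hgf₂⟩ := hleg b hb (by omega)
  obtain ⟨g₃, hg₃, hf₃, hgf₃⟩ := hleg c hc (by omega)
  exact _root_.nonempty_iso_star222 hG hab hac hbc hg₁ hg₂ hg₃ hNv hf₁ hf₂ hf₃ hgf₁ hgf₂ hgf₃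

end

/-! ### Trees -/

theorem SimpleGraph.IsTree.exists_isLeafVertex {V : Type*} [Finite V] {T : SimpleGraph V}
    (hT : T.IsTree) : ∃ r, IsLeafVertex T r := by
  classical
  have := Fintype.ofFinite V
  have := hT.connected.nonempty
  obtain hV | hV := subsingleton_or_nontrivial V
  · exact ⟨Classical.arbitrary V, fun y z _ _ => Subsingleton.elim y z⟩
  · obtain ⟨r, hr⟩ := hT.exists_vert_degree_one_of_nontrivial
    obtain ⟨w, _, hw⟩ := SimpleGraph.degree_eq_one_iff_existsUnique_adj.1 hr
    exact ⟨r, fun y z hy hz => (hw y hy).trans (hw z hz).symm⟩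

theorem corollary3p13 {V : Type*} [Finite V] (T : SimpleGraph V) (hT : T.IsTree)
    (hfailed : WellFailed T) (hpath : ¬ IsPathOnSomeVertices T)
    (hstar : ¬ Nonempty (T ≃g star222)) : WellForced T := by
  have := Fintype.ofFinite V
  by_cases htw : ∀ p x y, T.Adj p x → T.Adj p y → IsLeafVertex T x → IsLeafVertex T y → x = y
  · exfalso
    have hk : ∃ k, ∀ F, Minimal (IsFort T) F → F.ncard = k := by
      by_cases hF : ∃ F, Minimal (IsFort T) F
      · obtain ⟨F₀, hF₀⟩ := hF
        exact ⟨F₀.ncard, fun F hF => hfailed.ncard_eq hF hF₀⟩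
      · exact ⟨0, fun F h => absurd ⟨F, h⟩ hF⟩
    obtain ⟨k, hk⟩ := hk
    obtain ⟨s, hs⟩ := exists_isContinuationSize hT.isAcyclic htw hk
    obtain ⟨r, hr⟩ := hT.exists_isLeafVertex
    refine hpath (isPathOnSomeVertices_of_forall_adj hT.connected hr ?_)
    intro v a b c ha hb hc
    by_contra hne
    push Not at hne
    exact hstar (hs.nonempty_iso_star222 hT.connected htw ha hb hc hne.1 hne.2.1 hne.2.2)
  · push Not at htw
    obtain ⟨p, x, y, hpx, hpy, hx, hy, hxy⟩ := htw
    refine wellForced_of_forall_ncard_eq_two fun F hF => ?_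
    rw [hfailed.ncard_eq hF (minimal_isFort_pair_of_isLeafVertex hpx hpy hx hy hxy),
      Set.ncard_pair hxy]
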